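/- **Setting.** Let $V$ be a finite set of program variables and $\Sigma=\{s\colon V\to\mathbb{Q}\}$ the set of program states. An *expectation* is a function $f\colon\Sigma\to[0,\infty]$; expectations are ordered pointwise ($\preceq$), and $f$ is *finite* if $f(s)<\infty$ for all $s$, *bounded* if $f\le c$ for some real constant $c\ge 0$. Programs are $$C ::= \mathtt{skip}\mid b:=e\mid \mathtt{if}\,(\varphi)\,\{C\}\,\mathtt{else}\,\{C\}\mid \{C\}\,[p]\,\{C\}\mid C;C\mid \mathtt{while}(\varphi)\{C\},\qquad p\in[0,1],$$ where expressions $e$ and guards $\varphi$ denote functions $\Sigma\to\mathbb{Q}$ and predicates on $\Sigma$. With Iverson brackets $[\varphi]$ and the convention $0\cdot\infty=0$, the weakest preexpectation transformer is given by $\mathrm{wp}(\mathtt{skip},f)=f$, $\mathrm{wp}(b:=e,f)(s)=f(s[b/s(e)])$, $\mathrm{wp}(\mathtt{if}\,(\varphi)\{C_1\}\,\mathtt{else}\,\{C_2\},f)=[\varphi]\,\mathrm{wp}(C_1,f)+[\neg\varphi]\,\mathrm{wp}(C_2,f)$, $\mathrm{wp}(\{C_1\}[p]\{C_2\},f)=p\,\mathrm{wp}(C_1,f)+(1-p)\,\mathrm{wp}(C_2,f)$,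 $\mathrm{wp}(C_1;C_2,f)=\mathrm{wp}(C_1,\mathrm{wp}(C_2,f))$, and $\mathrm{wp}(\mathtt{while}(\varphi)\{C\},f)=\operatorname{lfp}\Phi_f$, where $$\Phi_f(X)=[\neg\varphi]\cdot f+[\varphi]\cdot\mathrm{wp}(C,X)$$ and the least fixed point is taken with respect to $\preceq$. Let ${}^{s}\mu_C(t)$ be the probability that $C$, started in $s$, terminates in the state $t$. The program $C$ is *AST* (universally almost-surely terminating) if $\sum_t{}^{s}\mu_C(t)=1$ for every $s\in\Sigma$. Fix a loop $\mathtt{while}(\varphi)\{C\}$ with AST body $C$. For $s\in\Sigma$ let ${}^{s}\mathbb{P}$ be the law on $\Sigma^{\mathbb{N}}$ of the Markov chain $\vartheta[0],\vartheta[1],\dots$ with $\vartheta[0]=s$ that moves from $u$ according to ${}^{u}\mu_C$ if $u\models\varphi$ and stays at $u$ otherwise. The *looping time* is $T(\vartheta)=\inf\{n\mid \vartheta[n]\not\models\varphi\}\in\mathbb{N}\cup\{\infty\}$. An expectation $X$ is *uniformly integrable for $f$* if $\lim_{n\to\infty}\Phi_f^n(X)$ exists pointwise and equals $\operatorname{lfp}\Phi_f$.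 An expectation $I$ *harmonizes with $f$* if $I=[\neg\varphi]\cdot f+[\varphi]\cdot I'$ for some expectation $I'$. A finite expectation $I$ is *conditionally difference bounded* if there is a real $c\ge0$ such that for all $s\in\Sigma$ $$\Delta I(s):=[\varphi](s)\cdot\mathrm{wp}\bigl(C,\;t\mapsto|I(t)-I(s)|\bigr)(s)\le c .$$ **Theorem (Optional Stopping Theorem for Weakest Preexpectation Reasoning).** Let $C$ be AST, let $f$ be a finite expectation, and let $I$ be a finite expectation with $I\preceq\Phi_f(I)$. Then $I$ is uniformly integrable for $f$ if and only if $$I\;\preceq\;\operatorname{lfp}\Phi_f=\mathrm{wp}(\mathtt{while}(\varphi)\{C\},f).$$ Moreover, $I$ is uniformly integrable for $f$ if one of the following three conditions holds: (a) for every $s\in\Sigma$ there is $N(s)\in\mathbb{N}$ with ${}^{s}\mathbb{P}(T\le N(s))=1$, and $\Phi_f^n(I)$ is finite for every $n\in\mathbb{N}$; (b) the expected looping time ${}^{s}\mathbb{E}(T)$ is finite for every $s\in\Sigma$, $I$ harmonizes with $f$, $\Phi_f(I)$ is finite, and $I$ is conditionally difference bounded; (c) $f$ and $I$ are bounded and $\mathtt{while}(\varphi)\{C\}$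 is AST. -/

import Mathlib

open MeasureTheory ProbabilityTheory Filter Topology
open scoped ENNReal NNReal

namespace PGCL

/-- Program states: rational valuations of the program variables `V`. -/
abbrev State (V : Type*) := V → ℚ

/-- Expectations: functions from states to `[0, ∞]`, ordered pointwise. -/
abbrev Expectation (V : Type*) := State V → ℝ≥0∞

/-- Programs of the probabilistic guarded command language. Arithmetic expressions and guards are
represented by the functions and the predicates on states that they denote. -/
inductive Prog (V : Type*) where
  | skip : Prog V
  | assign (b : V) (e : State V → ℚ) : Prog V
  | ite (φ : State V → Prop) (C₁ C₂ : Prog V) : Prog V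
  | choice (p : ℝ≥0) (hp : p ≤ 1) (C₁ C₂ : Prog V) : Prog V
  | seq (C₁ C₂ : Prog V) : Prog V
  | loop (φ : State V → Prop) (C : Prog V) : Prog V

open Classical in
/-- The Iverson bracket `[φ]`. -/
noncomputable def iverson {V : Type*} (φ : State V → Prop) : Expectation V :=
  fun s => if φ s then 1 else 0

/-- The state `s[b / e]`. -/
noncomputable def subst {V : Type*} (s : State V) (b : V) (e : State V → ℚ) : State V :=
  open Classical in Function.update s b (e s)

/-! ### Weakest preexpectations -/

/-- For a loop with guard `φ` whose body has the expectation transformer `W`: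
`X ↦ [¬φ] · f + [φ] · W X`, as a monotone map. -/
noncomputable def charMap {V : Type*} (φ : State V → Prop)
    (W : Expectation V →o Expectation V) (f : Expectation V) :
    Expectation V →o Expectation V where
  toFun X := fun s => iverson (fun t => ¬ φ t) s * f s + iverson φ s * W X s
  monotone' X Y h s := by
    have := W.monotone h s
    dsimp only
    gcongr

/-- The weakest preexpectation transformer, bundled with its monotonicity. -/
noncomputable def wp {V : Type*} : Prog V → (Expectation V →o Expectation V)
  | .skip => OrderHom.id
  | .assign b e =>
    { toFun := fun f s => f (subst s b e)
      monotone' := fun _ _ h s => h (subst s b e) }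
  | .ite φ C₁ C₂ =>
    { toFun := fun f s => iverson φ s * wp C₁ f s + iverson (fun t => ¬ φ t) s * wp C₂ f s
      monotone' := fun _ _ h s => by
        have h₁ := (wp C₁).monotone h s
        have h₂ := (wp C₂).monotone h s
        dsimp only
        gcongr }
  | .choice p _ C₁ C₂ =>
    { toFun := fun f s => (p : ℝ≥0∞) * wp C₁ f s + (1 - (p : ℝ≥0∞)) * wp C₂ f s
      monotone' := fun _ _ h s => by
        have h₁ := (wp C₁).monotone h s
        have h₂ := (wp C₂).monotone h s
        dsimp only
        gcongr }
  | .seq C₁ C₂ => (wp C₁).comp (wp C₂)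
  | .loop φ C =>
    { toFun := fun f => OrderHom.lfp (charMap φ (wp C) f)
      monotone' := fun f g h => OrderHom.lfp.monotone fun X s => by
        have := h s
        change iverson (fun t => ¬ φ t) s * f s + iverson φ s * wp C X s ≤
          iverson (fun t => ¬ φ t) s * g s + iverson φ s * wp C X s
        gcongr }

/-- The characteristic function `Φ_f` of `while (φ) {C}` with respect to `f`. -/
noncomputable def Phi {V : Type*} (φ : State V → Prop) (C : Prog V) (f : Expectation V) :
    Expectation V →o Expectation V :=
  charMap φ (wp C) f

/-! ### Distributions of final states, almost-sure termination -/

/-- For a guard `φ` and a body with final-state distributions `μ`: `iterDist φ μ n s t` is the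
probability that, started in `s`, at least `n` iterations of the loop are performed and the state
after the first `n` iterations is `t`. -/
noncomputable def iterDist {V : Type*} (φ : State V → Prop) (μ : State V → State V → ℝ≥0∞) :
    ℕ → State V → State V → ℝ≥0∞
  | 0, s, t => iverson (fun u => u = s) t
  | n + 1, s, t => iverson φ s * ∑' u, μ s u * iterDist φ μ n u t

/-- `finalDist C s t` is the probability that `C`, started in `s`, terminates in the final
state `t` (forward semantics; the missing mass is the probability of nontermination). A loop ends
in `t` if for some `n` it is in `t` after `n` iterations and `t` violates the guard. -/
noncomputable def finalDist {V : Type*} : Prog V → State V → State V → ℝ≥0∞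
  | .skip, s, t => iverson (fun u => u = s) t
  | .assign b e, s, t => iverson (fun u => u = subst s b e) t
  | .ite φ C₁ C₂, s, t =>
    iverson φ s * finalDist C₁ s t + iverson (fun u => ¬ φ u) s * finalDist C₂ s t
  | .choice p _ C₁ C₂, s, t =>
    (p : ℝ≥0∞) * finalDist C₁ s t + (1 - (p : ℝ≥0∞)) * finalDist C₂ s t
  | .seq C₁ C₂, s, t => ∑' u, finalDist C₁ s u * finalDist C₂ u t
  | .loop φ C, s, t =>
    ∑' n : ℕ, iterDist φ (finalDist C) n s t * iverson (fun u => ¬ φ u) t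

/-- Universal almost-sure termination: on every input, `C` terminates with probability one. -/
def Prog.AST {V : Type*} (C : Prog V) : Prop :=
  ∀ s : State V, ∑' t, finalDist C s t = 1

/-! ### The canonical probability space of a loop -/

/-- The final-state distribution of an almost-surely terminating program, as a `PMF`. -/
noncomputable def bodyPMF {V : Type*} (C : Prog V) (hC : C.AST) (s : State V) : PMF (State V) :=
  ⟨finalDist C s, ENNReal.summable.hasSum_iff.2 (hC s)⟩

open Classical in
/-- One step of a run of `while (φ) {C}`: execute the body if `φ` holds, stay put otherwise. -/
noncomputable def stepPMF {V : Type*} (φ : State V → Prop) (C : Prog V) (hC : C.AST)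
    (s : State V) : PMF (State V) :=
  if φ s then bodyPMF C hC s else PMF.pure s

/-- The one-step Markov kernel of the loop (the state space is countable and discrete). -/
noncomputable def stepKernel {V : Type*} [Finite V] (φ : State V → Prop) (C : Prog V)
    (hC : C.AST) : Kernel (State V) (State V) where
  toFun s := (stepPMF φ C hC s).toMeasure
  measurable' := Measurable.of_discrete

instance {V : Type*} [Finite V] (φ : State V → Prop) (C : Prog V) (hC : C.AST) :
    IsMarkovKernel (stepKernel φ C hC) :=
  ⟨fun s => PMF.toMeasure.isProbabilityMeasure (stepPMF φ C hC s)⟩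

/-- The conditional law of state `n + 1` of a run given its states `0, …, n`. -/
noncomputable def runKernel {V : Type*} [Finite V] (φ : State V → Prop) (C : Prog V)
    (hC : C.AST) (n : ℕ) : Kernel (Finset.Iic n → State V) (State V) :=
  (stepKernel φ C hC).comap (fun h => h ⟨n, Finset.mem_Iic.2 le_rfl⟩) (measurable_pi_apply _)

instance {V : Type*} [Finite V] (φ : State V → Prop) (C : Prog V) (hC : C.AST) (n : ℕ) :
    IsMarkovKernel (runKernel φ C hC n) := by
  unfold runKernel
  infer_instance

/-- The loop measure: the law, on the space `ℕ → State V` of runs with the product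
`σ`-algebra (which is generated by the cylinder sets), of the run of `while (φ) {C}` that
starts in `s`. -/
noncomputable def loopMeasure {V : Type*} [Finite V] (φ : State V → Prop) (C : Prog V)
    (hC : C.AST) (s : State V) : Measure (ℕ → State V) :=
  Kernel.traj (X := fun _ => State V) (runKernel φ C hC) 0 (fun _ => s)

/-- The looping time of a run: the least `n` whose state violates the guard, `⊤` if there is
none. -/
noncomputable def loopingTime {V : Type*} (φ : State V → Prop) (θ : ℕ → State V) : ℕ∞ :=
  ⨅ (n : ℕ) (_ : ¬ φ (θ n)), (n : ℕ∞)

/-! ### Properties of expectations -/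

/-- `f` takes only finite values. -/
def IsFinite {V : Type*} (f : Expectation V) : Prop := ∀ s, f s < ∞

/-- `f` is bounded by a finite constant. -/
def IsBounded {V : Type*} (f : Expectation V) : Prop := ∃ c : ℝ≥0, ∀ s, f s ≤ c

/-- `X` is uniformly integrable for `f`: the iterates `Φ_f^n(X)` converge (pointwise) to
`lfp Φ_f`. -/
def UniformlyIntegrable {V : Type*} (φ : State V → Prop) (C : Prog V) (f X : Expectation V) :
    Prop :=
  Tendsto (fun n : ℕ => (Phi φ C f)^[n] X) atTop (𝓝 (OrderHom.lfp (Phi φ C f)))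

/-- `I` harmonizes with `f`: `I = [¬φ] · f + [φ] · I'` for some expectation `I'`. -/
def Harmonizes {V : Type*} (φ : State V → Prop) (f I : Expectation V) : Prop :=
  ∃ I' : Expectation V, I = fun s => iverson (fun t => ¬ φ t) s * f s + iverson φ s * I' s

/-- `H(X) = [φ] · wp(C, X)`. -/
noncomputable def H {V : Type*} (φ : State V → Prop) (C : Prog V) (X : Expectation V) :
    Expectation V :=
  fun s => iverson φ s * wp C X s

/-- `ΔI(s) = H(|I - I(s)|)(s)`. Subtraction on `[0, ∞]` is truncated at `0`, so
`|a - b| = (a - b) + (b - a)`. -/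
noncomputable def Diff {V : Type*} (φ : State V → Prop) (C : Prog V) (I : Expectation V) :
    Expectation V :=
  fun s => H φ C (fun t => (I t - I s) + (I s - I t)) s

/-- Conditional difference boundedness. -/
def CondDiffBounded {V : Type*} (φ : State V → Prop) (C : Prog V) (I : Expectation V) : Prop :=
  ∃ c : ℝ≥0, ∀ s, Diff φ C I s ≤ c

end PGCL

/-!
With `H X = [φ] · wp C X`, the characteristic function of the loop is `Φ_f X = [¬φ] · f + H X`.
Since `wp C X` is the integral of `X` against the final-state distribution of `C`
(`wp_eq_tsum_finalDist`), `H` is linear and countably additive. Hence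
`Φ_f^n X = ∑_{k < n} H^k ([¬φ] · f) + H^n X` (`Phi_iterate`), and the least fixed point of `Φ_f` is
the full series `∑_k H^k ([¬φ] · f)` (`lfp_Phi`).

If `I ≤ Φ_f I`, the iterates `Φ_f^n I` increase. Their limit dominates `I`, and when `I` lies below
the least fixed point they are squeezed between the partial sums of the series and its value. This
is the equivalence `uniformlyIntegrable_iff_le_lfp`. Moreover `I ≤ lfp Φ_f + H^n I` for every `n`
(`le_lfp_add_H_iterate`), so each of the three criteria has to make the value of `I` on the runs
alive after `n` iterations negligible.

* Under the loop measure, `H^{n+1} 1` is the probability that the looping time exceeds `n`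
  (`loopMeasure_alive`). If it vanishes at `s` for some `n`, so does `H^{n+1} I`.
* If `I ≤ c`, then `H^n I ≤ c · H^n 1`, and `H^n 1` tends to `0` when the loop terminates almost
  surely.
* If `I` has conditional differences bounded by `c` and `g` is the expected looping time, then
  `H^j I ≤ I · H^j 1 + c · g` (`H_iterate_le_mul_add`): freezing `I` at the current state costs at
  most the sum of the later increments. Applying `H^m` gives
  `H^{m+j} I ≤ H^m (I · H^j 1) + c · H^m g`. The first term tends to `0` as `j → ∞` by dominated
  convergence, and the second, a tail of the convergent series for `g`, as `m → ∞`.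
-/

namespace PGCL

/-! ### The transformers as sums against the final-state distribution -/

section Transformers

variable {V : Type*} {φ : State V → Prop} {C : Prog V}

lemma iverson_of_pos {s : State V} (h : φ s) : iverson φ s = 1 := if_pos h

lemma iverson_of_neg {s : State V} (h : ¬ φ s) : iverson φ s = 0 := if_neg h

lemma iverson_not_add (φ : State V → Prop) (s : State V) :
    iverson (fun t => ¬ φ t) s + iverson φ s = 1 := by
  by_cases h : φ s <;> simp [iverson, h]

lemma tsum_iverson_eq_mul (a : State V) (X : Expectation V) :
    ∑' t, iverson (fun u => u = a) t * X t = X a := by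
  rw [tsum_eq_single a fun t ht => by simp [iverson, ht]]
  simp [iverson]

/-- The expectation `[¬φ] · f`: the value collected by a loop that stops at once. -/
noncomputable def exitValue (φ : State V → Prop) (f : Expectation V) : Expectation V :=
  fun s => iverson (fun t => ¬ φ t) s * f s

lemma Phi_eq_add (f X : Expectation V) : Phi φ C f X = exitValue φ f + H φ C X := rfl

lemma H_mono {X Y : Expectation V} (h : X ≤ Y) : H φ C X ≤ H φ C Y := fun s => by
  have := (wp C).monotone h s
  dsimp only [H]
  gcongr

lemma monotone_H : Monotone (H φ C) := fun _ _ => H_mono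

lemma sum_iterDist_mul (hC : ∀ X s, wp C X s = ∑' t, finalDist C s t * X t) (X : Expectation V)
    (n : ℕ) (s : State V) :
    ∑' t, iterDist φ (finalDist C) n s t * X t = (H φ C)^[n] X s := by
  induction n generalizing s with
  | zero => simpa [iterDist] using tsum_iverson_eq_mul s X
  | succ n ih =>
    rw [Function.iterate_succ_apply', H, hC]
    simp only [iterDist, mul_assoc, ENNReal.tsum_mul_left, ← ih]
    congr 1
    simp only [← ENNReal.tsum_mul_left, ← ENNReal.tsum_mul_right, ← mul_assoc]
    exact ENNReal.tsum_comm

/- The lemmas ending in `_of_wp` assume the sum formula for the body `C` only: they serve the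
induction step for loops in its proof. -/

lemma H_add_of_wp (hC : ∀ X s, wp C X s = ∑' t, finalDist C s t * X t) (X Y : Expectation V) :
    H φ C (X + Y) = H φ C X + H φ C Y := by
  funext s
  simp only [H, hC, Pi.add_apply, mul_add, ENNReal.tsum_add]

lemma H_tsum_of_wp (hC : ∀ X s, wp C X s = ∑' t, finalDist C s t * X t)
    (X : ℕ → Expectation V) :
    H φ C (fun s => ∑' n, X n s) = fun s => ∑' n, H φ C (X n) s := by
  funext s
  simp only [H, hC, ← ENNReal.tsum_mul_left]
  exact ENNReal.tsum_comm

lemma H_iterate_add_of_wp (hC : ∀ X s, wp C X s = ∑' t, finalDist C s t * X t) (n : ℕ)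
    (X Y : Expectation V) :
    (H φ C)^[n] (X + Y) = (H φ C)^[n] X + (H φ C)^[n] Y := by
  induction n generalizing X Y with
  | zero => rfl
  | succ n ih => simp only [Function.iterate_succ_apply, H_add_of_wp hC, ih]

lemma Phi_iterate_of_wp (hC : ∀ X s, wp C X s = ∑' t, finalDist C s t * X t)
    (f X : Expectation V) (n : ℕ) :
    (Phi φ C f)^[n] X =
      ∑ k ∈ Finset.range n, (H φ C)^[k] (exitValue φ f) + (H φ C)^[n] X := by
  induction n generalizing X with
  | zero => simp
  | succ n ih =>
    rw [Function.iterate_succ_apply, ih, Phi_eq_add, H_iterate_add_of_wp hC,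
      Finset.sum_range_succ, Function.iterate_succ_apply, add_assoc]

lemma lfp_Phi_of_wp (hC : ∀ X s, wp C X s = ∑' t, finalDist C s t * X t) (f : Expectation V)
    (s : State V) :
    OrderHom.lfp (Phi φ C f) s = ∑' n, (H φ C)^[n] (exitValue φ f) s := by
  apply le_antisymm
  · refine OrderHom.lfp_le (Phi φ C f) (a := fun s => ∑' n, (H φ C)^[n] (exitValue φ f) s)
      (fun s => le_of_eq ?_) s
    rw [Phi_eq_add, H_tsum_of_wp hC]
    refine Eq.trans ?_ (tsum_eq_zero_add' ENNReal.summable).symm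
    simp only [Function.iterate_succ_apply', Function.iterate_zero, id, Pi.add_apply]
  · refine ENNReal.tsum_le_of_sum_range_le fun n => ?_
    have h := (Phi φ C f).monotone.iterate n (bot_le (a := OrderHom.lfp (Phi φ C f)))
    rw [((Phi φ C f).isFixedPt_lfp.iterate n).eq, Phi_iterate_of_wp hC] at h
    refine le_trans ?_ (h s)
    simp only [Pi.add_apply, Finset.sum_apply]
    exact le_self_add

/-- The weakest preexpectation is the expected value of the postexpectation under the forward
semantics. -/
theorem wp_eq_tsum_finalDist (C : Prog V) (X : Expectation V) (s : State V) :
    wp C X s = ∑' t, finalDist C s t * X t := by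
  induction C generalizing X s with
  | skip => exact (tsum_iverson_eq_mul s X).symm
  | assign b e => exact (tsum_iverson_eq_mul (subst s b e) X).symm
  | ite φ C₁ C₂ h₁ h₂ =>
    change iverson φ s * wp C₁ X s + iverson (fun t => ¬ φ t) s * wp C₂ X s = _
    simp only [h₁, h₂, finalDist, add_mul, ENNReal.tsum_add, mul_assoc, ENNReal.tsum_mul_left]
  | choice p hp C₁ C₂ h₁ h₂ =>
    change (p : ℝ≥0∞) * wp C₁ X s + (1 - (p : ℝ≥0∞)) * wp C₂ X s = _
    simp only [h₁, h₂, finalDist, add_mul, ENNReal.tsum_add, mul_assoc, ENNReal.tsum_mul_left]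
  | seq C₁ C₂ h₁ h₂ =>
    change wp C₁ (wp C₂ X) s = _
    simp only [h₁, h₂, finalDist, ← ENNReal.tsum_mul_left, ← ENNReal.tsum_mul_right, ← mul_assoc]
    exact ENNReal.tsum_comm
  | loop φ C hC =>
    change OrderHom.lfp (Phi φ C X) s = _
    rw [lfp_Phi_of_wp hC]
    simp only [finalDist, ← sum_iterDist_mul hC, exitValue, ← ENNReal.tsum_mul_right, mul_assoc]
    exact ENNReal.tsum_comm

lemma H_add (X Y : Expectation V) : H φ C (X + Y) = H φ C X + H φ C Y :=
  H_add_of_wp (wp_eq_tsum_finalDist C) X Y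

lemma H_tsum (X : ℕ → Expectation V) :
    H φ C (fun s => ∑' n, X n s) = fun s => ∑' n, H φ C (X n) s :=
  H_tsum_of_wp (wp_eq_tsum_finalDist C) X

lemma H_iterate_add (n : ℕ) (X Y : Expectation V) :
    (H φ C)^[n] (X + Y) = (H φ C)^[n] X + (H φ C)^[n] Y :=
  H_iterate_add_of_wp (wp_eq_tsum_finalDist C) n X Y

lemma H_const_mul (a : ℝ≥0∞) (X : Expectation V) :
    H φ C (fun s => a * X s) = fun s => a * H φ C X s := by
  funext s
  simp only [H, wp_eq_tsum_finalDist C, mul_left_comm _ a, ENNReal.tsum_mul_left]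

lemma H_iterate_const_mul (n : ℕ) (a : ℝ≥0∞) (X : Expectation V) :
    (H φ C)^[n] (fun s => a * X s) = fun s => a * (H φ C)^[n] X s := by
  induction n generalizing X with
  | zero => rfl
  | succ n ih => simp only [Function.iterate_succ_apply, H_const_mul, ih]

/-- `Φ_f^n(X)` splits into the value collected in fewer than `n` iterations and the value that
`X` assigns to the runs still alive after `n` iterations. -/
lemma Phi_iterate (f X : Expectation V) (n : ℕ) :
    (Phi φ C f)^[n] X =
      ∑ k ∈ Finset.range n, (H φ C)^[k] (exitValue φ f) + (H φ C)^[n] X :=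
  Phi_iterate_of_wp (wp_eq_tsum_finalDist C) f X n

lemma lfp_Phi (f : Expectation V) (s : State V) :
    OrderHom.lfp (Phi φ C f) s = ∑' n, (H φ C)^[n] (exitValue φ f) s :=
  lfp_Phi_of_wp (wp_eq_tsum_finalDist C) f s

/-! ### Subinvariants and the least fixed point -/

lemma le_Phi_iterate {f I : Expectation V} (h : I ≤ Phi φ C f I) (n : ℕ) :
    I ≤ (Phi φ C f)^[n] I := by
  simpa using (Phi φ C f).monotone.monotone_iterate_of_le_map h (Nat.zero_le n)

lemma uniformlyIntegrable_iff_le_lfp {f I : Expectation V} (h : I ≤ Phi φ C f I) :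
    UniformlyIntegrable φ C f I ↔ I ≤ OrderHom.lfp (Phi φ C f) := by
  refine ⟨fun hI => ge_of_tendsto' hI (le_Phi_iterate h), fun hI => tendsto_pi_nhds.2 fun s => ?_⟩
  -- The iterates lie between the partial sums of the series for the fixed point and the fixed
  -- point itself.
  have hlim := ENNReal.tendsto_nat_tsum fun n => (H φ C)^[n] (exitValue φ f) s
  rw [← lfp_Phi] at hlim
  refine tendsto_of_tendsto_of_tendsto_of_le_of_le hlim tendsto_const_nhds (fun n => ?_) fun n => ?_
  · simp only [Phi_iterate, Pi.add_apply, Finset.sum_apply]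
    exact le_self_add
  · have := (Phi φ C f).monotone.iterate n hI s
    rwa [((Phi φ C f).isFixedPt_lfp.iterate n).eq] at this

/-- A subinvariant exceeds the least fixed point by at most the value it assigns to the runs that
are still alive after `n` iterations. -/
lemma le_lfp_add_H_iterate {f I : Expectation V} (h : I ≤ Phi φ C f I) (n : ℕ) (s : State V) :
    I s ≤ OrderHom.lfp (Phi φ C f) s + (H φ C)^[n] I s := by
  refine (le_Phi_iterate h n s).trans ?_
  simp only [Phi_iterate, Pi.add_apply, Finset.sum_apply, lfp_Phi]
  gcongr
  exact ENNReal.sum_le_tsum _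

lemma le_lfp_of_tendsto_H_iterate {f I : Expectation V} (h : I ≤ Phi φ C f I)
    (hlim : ∀ s, Tendsto (fun n => (H φ C)^[n] I s) atTop (𝓝 0)) :
    I ≤ OrderHom.lfp (Phi φ C f) := fun s => by
  have := (hlim s).const_add (OrderHom.lfp (Phi φ C f) s)
  rw [add_zero] at this
  exact ge_of_tendsto' this fun n => le_lfp_add_H_iterate h n s

/-! ### Survival probabilities -/

lemma wp_one (hC : C.AST) : wp C 1 = 1 := by
  funext s
  simpa [wp_eq_tsum_finalDist] using hC s

lemma H_one (hC : C.AST) : H φ C 1 = iverson φ := by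
  funext s
  simp [H, wp_one hC]

lemma H_iterate_one_le_one (hC : C.AST) (n : ℕ) : (H φ C)^[n] 1 ≤ 1 := by
  have h : H φ C 1 ≤ 1 := fun s => by
    rw [H_one hC]
    by_cases h : φ s <;> simp [iverson, h]
  simpa using monotone_H.antitone_iterate_of_map_le h (Nat.zero_le n)

/-- The probability that an almost-surely terminating loop performs at least `n` iterations is the
mass missing from the first `n` terms of the series for `wp (while (φ) {C}) 1 = 1`. -/
lemma tendsto_H_iterate_one (hC : C.AST) (hloop : (Prog.loop φ C).AST) (s : State V) :
    Tendsto (fun n => (H φ C)^[n] 1 s) atTop (𝓝 0) := by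
  have hsum : ∑' n, (H φ C)^[n] (exitValue φ 1) s = 1 := by
    rw [← lfp_Phi]
    exact congrFun (wp_one hloop) s
  have hfix : Function.IsFixedPt (Phi φ C 1) 1 := by
    funext s
    simpa [Phi_eq_add, H_one hC, exitValue] using iverson_not_add φ s
  have hsplit (n : ℕ) :
      (H φ C)^[n] 1 s = 1 - ∑ k ∈ Finset.range n, (H φ C)^[k] (exitValue φ 1) s := by
    have h := congrFun (Phi_iterate (φ := φ) (C := C) 1 1 n) s
    rw [(hfix.iterate n).eq, Pi.add_apply, Finset.sum_apply, Pi.one_apply] at h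
    refine ENNReal.eq_sub_of_add_eq ?_ (by rw [add_comm, ← h])
    exact ne_top_of_le_ne_top ENNReal.one_ne_top (h ▸ le_self_add)
  simp only [hsplit]
  have := ENNReal.Tendsto.sub (tendsto_const_nhds (x := (1 : ℝ≥0∞)))
    (ENNReal.tendsto_nat_tsum fun n => (H φ C)^[n] (exitValue φ 1) s) (.inl ENNReal.one_ne_top)
  rwa [hsum, tsub_self] at this

lemma le_lfp_of_isBounded {f I : Expectation V} (hC : C.AST) (h : I ≤ Phi φ C f I)
    (hI : IsBounded I) (hloop : (Prog.loop φ C).AST) : I ≤ OrderHom.lfp (Phi φ C f) := by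
  obtain ⟨c, hc⟩ := hI
  refine le_lfp_of_tendsto_H_iterate h fun s => ?_
  have hlim := ENNReal.Tendsto.const_mul (a := (c : ℝ≥0∞)) (tendsto_H_iterate_one hC hloop s)
    (.inr ENNReal.coe_ne_top)
  rw [mul_zero] at hlim
  refine tendsto_of_tendsto_of_tendsto_of_le_of_le tendsto_const_nhds hlim
    (fun n => zero_le) fun n => ?_
  have := (monotone_H (φ := φ) (C := C)).iterate n
    (show I ≤ fun s => (c : ℝ≥0∞) * (1 : Expectation V) s from fun s => by simpa using hc s) s
  rwa [H_iterate_const_mul] at this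

lemma le_lfp_of_H_iterate_one_eq_zero {f I : Expectation V} (h : I ≤ Phi φ C f I)
    (hzero : ∀ s, ∃ n, (H φ C)^[n] 1 s = 0) : I ≤ OrderHom.lfp (Phi φ C f) := fun s => by
  obtain ⟨n, hn⟩ := hzero s
  have hI : (H φ C)^[n] I s = 0 := by
    rw [← sum_iterDist_mul (wp_eq_tsum_finalDist C)] at hn ⊢
    simp only [Pi.one_apply, mul_one, ENNReal.tsum_eq_zero] at hn
    simp [hn]
  simpa [hI] using le_lfp_add_H_iterate h n s

end Transformers

/-! ### Finite expected looping time -/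

section ExpectedTime

variable {V : Type*} {φ : State V → Prop} {C : Prog V}

/-- The expected looping time from `s`, as the sum over `n` of the probabilities that more than
`n` iterations are performed. -/
noncomputable def expectedTime (φ : State V → Prop) (C : Prog V) : Expectation V :=
  fun s => ∑' n, (H φ C)^[n + 1] 1 s

lemma H_iterate_expectedTime (m : ℕ) (s : State V) :
    (H φ C)^[m] (expectedTime φ C) s = ∑' n, (H φ C)^[n + m + 1] 1 s := by
  induction m generalizing s with
  | zero => rfl
  | succ m ih =>
    rw [Function.iterate_succ_apply', show (H φ C)^[m] (expectedTime φ C) = _ from funext ih,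
      H_tsum]
    simp only [← Function.iterate_succ_apply' (H φ C)]
    rfl

/-- Over the runs alive after `j` iterations, the value of `I` exceeds its starting value by at
most the sum of its increments, and the expected increment in an iteration is at most `c` times
the probability that this iteration is performed. -/
lemma H_iterate_le_mul_add {I : Expectation V} (hC : C.AST) {c : ℝ≥0}
    (hc : ∀ s, Diff φ C I s ≤ c) (j : ℕ) (s : State V) :
    (H φ C)^[j] I s ≤
      I s * (H φ C)^[j] 1 s + c * ∑ i ∈ Finset.range j, (H φ C)^[i + 1] 1 s := by
  induction j generalizing s with
  | zero => simp
  | succ j ih =>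
    -- Freeze the starting state `s` before one step is taken; the survival factor is at most `1`.
    have key : (H φ C)^[j] I ≤ ((fun t => I s * (H φ C)^[j] 1 t) +
        (fun t => (I t - I s) + (I s - I t))) +
        (fun t => (c : ℝ≥0∞) * ∑ i ∈ Finset.range j, (H φ C)^[i + 1] 1 t) := fun t => by
      refine (ih t).trans ?_
      simp only [Pi.add_apply]
      gcongr
      calc I t * (H φ C)^[j] 1 t ≤ (I s + (I t - I s)) * (H φ C)^[j] 1 t := by
            gcongr
            exact le_add_tsub
        _ ≤ I s * (H φ C)^[j] 1 t + (I t - I s) * 1 := by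
            rw [add_mul]
            gcongr
            exact H_iterate_one_le_one hC j t
        _ ≤ _ := by
            rw [mul_one]
            gcongr
            exact le_self_add
    have hsum (n : ℕ) : H φ C (fun t => ∑ i ∈ Finset.range n, (H φ C)^[i + 1] 1 t) s =
        ∑ i ∈ Finset.range n, (H φ C)^[i + 2] 1 s := by
      induction n with
      | zero => simp [H, wp_eq_tsum_finalDist]
      | succ n ihn =>
        simp only [Finset.sum_range_succ]
        rw [← ihn, Function.iterate_succ_apply' _ (n + 1)]
        exact congrFun (H_add _ _) s
    have hdiff : Diff φ C I s ≤ c * H φ C 1 s := by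
      by_cases h : φ s
      · simpa [H_one hC, iverson_of_pos h] using hc s
      · simp [Diff, H, iverson_of_neg h]
    rw [Function.iterate_succ_apply']
    refine (H_mono key s).trans ?_
    rw [H_add, H_add, H_const_mul, H_const_mul, Pi.add_apply, Pi.add_apply, hsum,
      Finset.sum_range_succ' _ j, mul_add, Function.iterate_succ_apply' _ j, add_assoc,
      add_comm (_ * ∑ i ∈ _, _) _]
    gcongr
    exact hdiff

/-- Dominated convergence for the transformer `H`. -/
lemma tendsto_H_of_dominated [Finite V] {X : Expectation V} {Y : ℕ → Expectation V}
    {s : State V} (hX : H φ C X s < ∞) (hY : ∀ j, Y j ≤ X)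
    (hlim : ∀ t, Tendsto (fun j => Y j t) atTop (𝓝 0)) :
    Tendsto (fun j => H φ C (Y j) s) atTop (𝓝 0) := by
  by_cases h : φ s
  · simp only [H, iverson_of_pos h, one_mul, wp_eq_tsum_finalDist C] at hX ⊢
    simp only [← lintegral_count] at hX ⊢
    have hlim' : ∀ t, Tendsto (fun j => finalDist C s t * Y j t) atTop (𝓝 0) := fun t => by
      by_cases htop : finalDist C s t = ∞
      · by_cases hXt : X t = 0
        · have (j : ℕ) : Y j t = 0 := le_antisymm (hXt ▸ hY j t) zero_le
          simp [this]
        · refine absurd ?_ hX.ne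
          rw [lintegral_count, ENNReal.tsum_eq_top_of_eq_top ⟨t, by rw [htop, ENNReal.top_mul hXt]⟩]
      · simpa using ENNReal.Tendsto.const_mul (hlim t) (.inr htop)
    have := tendsto_lintegral_of_dominated_convergence (μ := Measure.count)
      (F := fun j t => finalDist C s t * Y j t) (f := fun _ => 0)
      (fun t => finalDist C s t * X t) (fun j => .of_discrete)
      (fun j => .of_forall fun t => mul_le_mul' le_rfl (hY j t)) hX.ne (.of_forall hlim')
    simpa using this
  · simp [H, iverson_of_neg h]

lemma le_lfp_of_condDiffBounded [Finite V] {f I : Expectation V} (hC : C.AST)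
    (h : I ≤ Phi φ C f I) (hI : IsFinite I) (hdiff : CondDiffBounded φ C I)
    (htime : IsFinite (expectedTime φ C)) : I ≤ OrderHom.lfp (Phi φ C f) := by
  obtain ⟨c, hc⟩ := hdiff
  have hbound (j : ℕ) (s : State V) :
      (H φ C)^[j] I s ≤ I s * (H φ C)^[j] 1 s + c * expectedTime φ C s := by
    refine (H_iterate_le_mul_add hC hc j s).trans ?_
    gcongr
    exact ENNReal.sum_le_tsum (f := fun i => (H φ C)^[i + 1] 1 s) _
  have hfin (j : ℕ) (s : State V) : (H φ C)^[j] I s < ∞ := by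
    refine (hbound j s).trans_lt (ENNReal.add_lt_top.2 ⟨?_, ?_⟩)
    · exact ENNReal.mul_lt_top (hI s) ((H_iterate_one_le_one hC j s).trans_lt ENNReal.one_lt_top)
    · exact ENNReal.mul_lt_top ENNReal.coe_lt_top (htime s)
  have hsurv (s : State V) : Tendsto (fun j => (H φ C)^[j] 1 s) atTop (𝓝 0) :=
    (tendsto_add_atTop_iff_nat 1).1 (ENNReal.tendsto_atTop_zero_of_tsum_ne_top (htime s).ne)
  have hdom (m : ℕ) (s : State V) :
      Tendsto (fun j => (H φ C)^[m] (fun t => I t * (H φ C)^[j] 1 t) s) atTop (𝓝 0) := by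
    have hle (j : ℕ) : (fun t => I t * (H φ C)^[j] 1 t) ≤ I := fun t =>
      mul_le_of_le_one_right' (H_iterate_one_le_one hC j t)
    induction m generalizing s with
    | zero => simpa using ENNReal.Tendsto.const_mul (hsurv s) (.inr (hI s).ne)
    | succ m ih =>
      simp only [Function.iterate_succ_apply']
      refine tendsto_H_of_dominated (X := (H φ C)^[m] I) ?_
        (fun j => monotone_H.iterate m (hle j)) ih
      rw [← Function.iterate_succ_apply' (H φ C)]
      exact hfin _ s
  -- First the number `j` of further iterations tends to infinity, then the number `m` of
  -- iterations whose increments are kept.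
  have hstep (m : ℕ) (s : State V) :
      I s ≤ OrderHom.lfp (Phi φ C f) s + c * (H φ C)^[m] (expectedTime φ C) s := by
    have hlim := ((hdom m s).add_const (c * (H φ C)^[m] (expectedTime φ C) s)).const_add
      (OrderHom.lfp (Phi φ C f) s)
    rw [zero_add] at hlim
    refine ge_of_tendsto' hlim fun j => (le_lfp_add_H_iterate h (m + j) s).trans ?_
    gcongr
    rw [Function.iterate_add_apply]
    refine (monotone_H.iterate m (hbound j) s).trans (le_of_eq ?_)
    have := congrFun (H_iterate_add (φ := φ) (C := C) m (fun t => I t * (H φ C)^[j] 1 t)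
      (fun t => c * expectedTime φ C t)) s
    rwa [H_iterate_const_mul] at this
  intro s
  have htail : Tendsto (fun m => (H φ C)^[m] (expectedTime φ C) s) atTop (𝓝 0) := by
    simp only [H_iterate_expectedTime]
    exact ENNReal.tendsto_sum_nat_add (fun n => (H φ C)^[n + 1] 1 s) (htime s).ne
  have hlim := (ENNReal.Tendsto.const_mul (a := (c : ℝ≥0∞)) htail
    (.inr ENNReal.coe_ne_top)).const_add (OrderHom.lfp (Phi φ C f) s)
  rw [mul_zero, add_zero] at hlim
  exact ge_of_tendsto' hlim fun m => hstep m s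

end ExpectedTime

/-! ### Survival probabilities under the loop measure -/

/-- The runs that satisfy the guard at the times `0, …, n`, that is, whose looping time is
greater than `n`. -/
def alive {V : Type*} (φ : State V → Prop) (n : ℕ) : Set (ℕ → State V) := {θ | ∀ k ≤ n, φ (θ k)}

lemma mem_alive_iff_not_loopingTime_le {V : Type*} {φ : State V → Prop} {n : ℕ}
    {θ : ℕ → State V} : θ ∈ alive φ n ↔ ¬ loopingTime φ θ ≤ n := by
  rw [not_le, ← ENat.add_one_le_iff (ENat.natCast_ne_top n), loopingTime]
  simp only [le_iInf_iff, alive, Set.mem_ofPred_eq]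
  refine forall_congr' fun k => ?_
  rw [← not_imp_not, not_le, imp_congr_right fun _ => ?_]
  norm_cast

lemma tsum_indicator_alive_le {V : Type*} (φ : State V → Prop) (θ : ℕ → State V) :
    ∑' n, (alive φ n).indicator 1 θ ≤ (loopingTime φ θ : ℝ≥0∞) := by
  cases hT : loopingTime φ θ with
  | top => simp
  | coe k =>
    rw [tsum_eq_sum (s := Finset.range k) fun n hn => ?_]
    · refine (Finset.sum_le_card_nsmul _ _ 1 fun n _ => ?_).trans (by simp)
      exact Set.indicator_le_self' (fun _ _ => zero_le) θ
    · refine Set.indicator_of_notMem (fun h => mem_alive_iff_not_loopingTime_le.1 h ?_) _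
      rw [hT]
      exact_mod_cast not_lt.1 (Finset.mem_range.not.1 hn)

section LoopMeasure

variable {V : Type*} [Finite V] {φ : State V → Prop} {C : Prog V}

instance (hC : C.AST) (s : State V) : IsProbabilityMeasure (loopMeasure φ C hC s) := by
  unfold loopMeasure
  infer_instance

lemma lintegral_stepKernel (hC : C.AST) {s : State V} (h : φ s) (g : Expectation V) :
    ∫⁻ t, g t ∂(stepKernel φ C hC s) = wp C g s := by
  have hs : stepKernel φ C hC s = (bodyPMF C hC s).toMeasure := by
    change (stepPMF φ C hC s).toMeasure = _
    rw [stepPMF, if_pos h]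
  rw [hs, lintegral_countable', wp_eq_tsum_finalDist]
  refine tsum_congr fun t => ?_
  rw [PMF.toMeasure_apply_singleton _ _ (measurableSet_singleton t), mul_comm]
  rfl

/-- The Markov property of the loop measure at a fixed time. -/
lemma lintegral_loopMeasure_mul (hC : C.AST) (s : State V) (n : ℕ)
    (h : (Finset.Iic n → State V) → ℝ≥0∞) (g : Expectation V) :
    ∫⁻ θ, h (Preorder.frestrictLe n θ) * g (θ (n + 1)) ∂(loopMeasure φ C hC s) =
      ∫⁻ θ, h (Preorder.frestrictLe n θ) * ∫⁻ t, g t ∂(stepKernel φ C hC (θ n))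
        ∂(loopMeasure φ C hC s) := by
  have hh : Measurable h := .of_discrete
  have hg : Measurable g := .of_discrete
  have hm : Measurable fun p : (Finset.Iic n → State V) × State V => h p.1 * g p.2 :=
    (hh.comp measurable_fst).mul (hg.comp measurable_snd)
  have hpair := Kernel.partialTraj_compProd_eq_map_traj (X := fun _ => State V)
      (κ := runKernel φ C hC)
    (Nat.zero_le n) (x₀ := fun _ => s)
  have hfst := Kernel.traj_map_frestrictLe_apply (X := fun _ => State V)
      (κ := runKernel φ C hC) 0 n (fun _ => s)
  calc ∫⁻ θ, h (Preorder.frestrictLe n θ) * g (θ (n + 1)) ∂(loopMeasure φ C hC s)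
    _ = ∫⁻ p, h p.1 * g p.2 ∂((loopMeasure φ C hC s).map
          fun θ => (Preorder.frestrictLe n θ, θ (n + 1))) := by
        rw [lintegral_map hm (by fun_prop)]
    _ = ∫⁻ x, h x * ∫⁻ t, g t ∂(runKernel φ C hC n x)
          ∂((loopMeasure φ C hC s).map (Preorder.frestrictLe n)) := by
        rw [loopMeasure, ← hpair, hfst, Measure.lintegral_compProd hm]
        refine lintegral_congr fun x => ?_
        exact lintegral_const_mul (h x) hg
    _ = _ := by
        rw [lintegral_map .of_discrete (by fun_prop)]
        rfl

lemma measurableSet_alive (n : ℕ) : MeasurableSet (alive φ n) := by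
  simp only [alive, Set.ofPred_forall]
  exact .iInter fun k => .iInter fun _ => measurable_pi_apply k (.of_discrete (s := {s | φ s}))

/-- Each step taken by a surviving run contributes one application of `H`. -/
lemma lintegral_indicator_alive_mul (hC : C.AST) (s : State V) (n : ℕ) (g : Expectation V) :
    ∫⁻ θ, (alive φ n).indicator 1 θ * g (θ n) ∂(loopMeasure φ C hC s) =
      (H φ C)^[n] (fun t => iverson φ t * g t) s := by
  classical
  induction n generalizing g with
  | zero =>
    have hstart := Kernel.traj_map_frestrictLe_apply (X := fun _ => State V)
      (κ := runKernel φ C hC) 0 0 (fun _ => s)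
    rw [Kernel.partialTraj_self, Kernel.id_apply] at hstart
    let G : (Finset.Iic 0 → State V) → ℝ≥0∞ := fun x =>
      iverson φ (x ⟨0, Finset.mem_Iic.2 le_rfl⟩) * g (x ⟨0, Finset.mem_Iic.2 le_rfl⟩)
    calc ∫⁻ θ, (alive φ 0).indicator 1 θ * g (θ 0) ∂(loopMeasure φ C hC s)
      _ = ∫⁻ θ, G (Preorder.frestrictLe 0 θ) ∂(loopMeasure φ C hC s) := by
        refine lintegral_congr fun θ => ?_
        change _ = iverson φ (θ 0) * g (θ 0)
        congr 1
        simp [alive, iverson, Set.indicator_apply]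
      _ = ∫⁻ x, G x ∂((loopMeasure φ C hC s).map (Preorder.frestrictLe 0)) := by
        rw [lintegral_map .of_discrete (by fun_prop)]
      _ = _ := by
        rw [loopMeasure, hstart, lintegral_dirac]
        rfl
  | succ n ih =>
    let h : (Finset.Iic n → State V) → ℝ≥0∞ := fun x => if ∀ i, φ (x i) then 1 else 0
    have hh (θ : ℕ → State V) :
        h (Preorder.frestrictLe n θ) = (alive φ n).indicator 1 θ := by
      simp only [h, alive, Set.indicator_apply, Subtype.forall, Finset.mem_Iic]
      exact if_congr Iff.rfl rfl rfl
    calc ∫⁻ θ, (alive φ (n + 1)).indicator 1 θ * g (θ (n + 1)) ∂(loopMeasure φ C hC s)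
      _ = ∫⁻ θ, h (Preorder.frestrictLe n θ) * (iverson φ (θ (n + 1)) * g (θ (n + 1)))
            ∂(loopMeasure φ C hC s) := by
        refine lintegral_congr fun θ => ?_
        rw [hh, ← mul_assoc]
        congr 1
        by_cases hφ : φ (θ (n + 1)) <;>
          simp [alive, iverson, Set.indicator_apply, Nat.le_succ_iff, or_imp, forall_and, hφ]
      _ = ∫⁻ θ, (alive φ n).indicator 1 θ * wp C (fun t => iverson φ t * g t) (θ n)
            ∂(loopMeasure φ C hC s) := by
        rw [lintegral_loopMeasure_mul hC s n h fun t => iverson φ t * g t]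
        refine lintegral_congr fun θ => ?_
        rw [hh]
        by_cases hθ : θ ∈ alive φ n
        · rw [lintegral_stepKernel hC (hθ n le_rfl)]
        · simp [hθ]
      _ = _ := by
        rw [ih, Function.iterate_succ_apply]
        rfl

lemma loopMeasure_alive (hC : C.AST) (s : State V) (n : ℕ) :
    loopMeasure φ C hC s (alive φ n) = (H φ C)^[n + 1] 1 s := by
  rw [Function.iterate_succ_apply, H_one hC, ← lintegral_indicator_one (measurableSet_alive n)]
  simpa using lintegral_indicator_alive_mul (φ := φ) hC s n 1

lemma H_iterate_one_eq_zero_of_loopingTime_le (hC : C.AST) {s : State V} {N : ℕ}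
    (h : loopMeasure φ C hC s {θ | loopingTime φ θ ≤ N} = 1) : (H φ C)^[N + 1] 1 s = 0 := by
  have hset : {θ | loopingTime φ θ ≤ N} = (alive φ N)ᶜ := by
    ext θ
    simp [mem_alive_iff_not_loopingTime_le]
  rwa [hset, prob_compl_eq_one_iff (measurableSet_alive N), loopMeasure_alive] at h

lemma expectedTime_le_lintegral_loopingTime (hC : C.AST) (s : State V) :
    expectedTime φ C s ≤ ∫⁻ θ, (loopingTime φ θ : ℝ≥0∞) ∂(loopMeasure φ C hC s) := by
  simp only [expectedTime, ← loopMeasure_alive hC,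
    ← lintegral_indicator_one (measurableSet_alive _)]
  rw [← lintegral_tsum fun n => (measurable_one.indicator (measurableSet_alive n)).aemeasurable]
  exact lintegral_mono fun θ => tsum_indicator_alive_le φ θ

end LoopMeasure

end PGCL

theorem mainTheorem1 {V : Type*} [Finite V] (φ : PGCL.State V → Prop) (C : PGCL.Prog V)
    (hC : C.AST) (f I : PGCL.Expectation V) (hf : PGCL.IsFinite f) (hI : PGCL.IsFinite I)
    (hsub : I ≤ PGCL.Phi φ C f I) :
    (PGCL.UniformlyIntegrable φ C f I ↔ I ≤ OrderHom.lfp (PGCL.Phi φ C f)) ∧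
    OrderHom.lfp (PGCL.Phi φ C f) = PGCL.wp (PGCL.Prog.loop φ C) f ∧
    ((∀ s, ∃ N : ℕ, PGCL.loopMeasure φ C hC s {θ | PGCL.loopingTime φ θ ≤ N} = 1) →
      (∀ n : ℕ, PGCL.IsFinite ((PGCL.Phi φ C f)^[n] I)) →
      PGCL.UniformlyIntegrable φ C f I) ∧
    ((∀ s, ∫⁻ θ, (PGCL.loopingTime φ θ : ℝ≥0∞) ∂(PGCL.loopMeasure φ C hC s) < ∞) →
      PGCL.Harmonizes φ f I →
      PGCL.IsFinite (PGCL.Phi φ C f I) →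
      PGCL.CondDiffBounded φ C I →
      PGCL.UniformlyIntegrable φ C f I) ∧
    (PGCL.IsBounded f → PGCL.IsBounded I → (PGCL.Prog.loop φ C).AST →
      PGCL.UniformlyIntegrable φ C f I) := by
  refine ⟨PGCL.uniformlyIntegrable_iff_le_lfp hsub, rfl, fun hT _ => ?_, fun hT _ _ hdiff => ?_,
    fun _ hbdd hloop => ?_⟩
  all_goals refine (PGCL.uniformlyIntegrable_iff_le_lfp hsub).2 ?_
  · refine PGCL.le_lfp_of_H_iterate_one_eq_zero hsub fun s => ?_
    obtain ⟨N, hN⟩ := hT s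
    exact ⟨N + 1, PGCL.H_iterate_one_eq_zero_of_loopingTime_le hC hN⟩
  · exact PGCL.le_lfp_of_condDiffBounded hC hsub hI hdiff fun s =>
      (PGCL.expectedTime_le_lintegral_loopingTime hC s).trans_lt (hT s)
  · exact PGCL.le_lfp_of_isBounded hC hsub hbdd hloop
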